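/- Let $E$ be a normed plane, i.e. a two-dimensional real normed space, with unit sphere $\mathbb{S}=\{x\in E:\|x\|=1\}$. Call $E$ \emph{angled} if there are non-collinear points $a,b,c$ with $[a,b]\cup[b,c]\subset\mathbb{S}$. A bounded set $C\subset E$ is \emph{complete} if no set of the same diameter properly contains $C$. A \emph{completion} of a set $S\subset E$ is a complete set that contains $S$ and has the same diameter as $S$; the set $S$ is a \emph{set of unique completion} if it has exactly one completion. For $k\in\mathbb{N}$, a (finite) \emph{$k$-fold Borsuk covering} of a set $A\subset E$ is a finite family $\{Q_1,\dots,Q_m\}$ (repetitions allowed) of subsets of $A$, each of diameter strictly less than the diameter of $A$, such that every point of $A$ belongs to $Q_i$ for at least $k$ indices $i$. \textbf{Theorem.} Let $E$ be a normed plane that is not angled, let $S\subset E$ be a set of unique completion, and let $C$ be the completion of $S$. Then every finite $k$-fold Borsuk covering $\{Q_1,\dots,Q_m\}$ of $S$ can be extended to a $k$-fold Borsuk covering of $C$: there is a $k$-fold Borsuk covering $\{Q_1',\dots,Q_m'\}$ of $C$ with $Q_i\subseteq Q_i'$ for every $i=1,\dots,m$. -/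

import Mathlib

/-- A normed plane (with unit sphere centred at the origin) is *angled* if its unit sphere contains
two segments `[a, b]` and `[b, c]` with `a`, `b`, `c` not collinear. -/
def IsAngled (E : Type*) [NormedAddCommGroup E] [NormedSpace ℝ E] : Prop :=
  ∃ a b c : E, ¬ Collinear ℝ {a, b, c} ∧ segment ℝ a b ∪ segment ℝ b c ⊆ Metric.sphere (0 : E) 1

/-- A bounded set `C` is (diametrically) *complete* if no set of the same diameter properly
contains it. The extended diameter is used, so that unbounded sets have diameter `∞`. -/
def IsDiamComplete {E : Type*} [NormedAddCommGroup E] (C : Set E) : Prop :=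
  Bornology.IsBounded C ∧ ∀ D : Set E, C ⊂ D → Metric.ediam D ≠ Metric.ediam C

/-- `C` is a *completion* of `S`: a complete set containing `S`, of the same diameter as `S`. -/
def IsCompletion {E : Type*} [NormedAddCommGroup E] (S C : Set E) : Prop :=
  IsDiamComplete C ∧ S ⊆ C ∧ Metric.ediam C = Metric.ediam S

/-- `S` is a *set of unique completion*: it has exactly one completion. -/
def IsSetOfUniqueCompletion {E : Type*} [NormedAddCommGroup E] (S : Set E) : Prop :=
  ∃! C : Set E, IsCompletion S C

/-- The family `Q` (indexed by `ι`) is a *`k`-fold Borsuk covering* of `S`: its members are subsets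
of `S` of diameter strictly less than that of `S`, and every point of `S` belongs to at least `k`
members. -/
def IsBorsukCovering {E : Type*} [NormedAddCommGroup E] {ι : Type*}
    (k : ℕ) (S : Set E) (Q : ι → Set E) : Prop :=
  (∀ i, Q i ⊆ S) ∧ (∀ i, Metric.ediam (Q i) < Metric.ediam S) ∧
    ∀ x ∈ S, (k : ℕ∞) ≤ Set.encard {i | x ∈ Q i}

open Set Metric Filter Topology

section

variable {E : Type*} [NormedAddCommGroup E]

/-! Uniqueness makes `C` the intersection of the balls of radius d, the diameter of `S`, about the
points of `S`; and `S` may be taken compact. Call two points of `C` partners if their distance is d.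
A compact part of `C` has diameter below d as soon as it contains no partners. So a point x off `S`
may join every `Q i` that contains a fixed x' in `S`, provided that all partners of x are partners
of x'. `exists_partner_superset_nhds` finds an x' that serves all points near x; finitely many such
neighbourhoods, and a thickening of the `Q i`, cover `C`.

Two facts give x'. By `exists_partner_superset`, x itself has a substitute: some point of `S` is at
distance at least d from any given point at distance d from x, and comparing crossing segments shows
that the directions from x to its partners fill flat pieces of the sphere. Without angles these lie
on one segment, and the point of `S` opposite its midpoint is x'. By `eventually_partner_subset`,
points near x have no partners but those of x: otherwise diametral segments tending to [x, y] would
each come with a further one ending in `S`, normed by the same functional, and comparing areas in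
the limit contradicts this. -/

/-! ### Completions, compactness and closures -/

theorem exists_isCompletion {A : Set E} (hA : ediam A ≠ ⊤) : ∃ D, IsCompletion A D := by
  obtain ⟨D, hAD, hmax⟩ := zorn_subset_nonempty {D : Set E | A ⊆ D ∧ ediam D ≤ ediam A} (by
    intro c hc hchain hne
    refine ⟨⋃₀ c, ⟨?_, ?_⟩, fun s hs => subset_sUnion_of_mem hs⟩
    · obtain ⟨s, hs⟩ := hne
      exact (hc hs).1.trans (subset_sUnion_of_mem hs)
    · refine ediam_le ?_
      rintro a ⟨s, hs, has⟩ b ⟨t, ht, hbt⟩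
      rcases hchain.total hs ht with hst | hst
      · exact (edist_le_ediam_of_mem (hst has) hbt).trans (hc ht).2
      · exact (edist_le_ediam_of_mem has (hst hbt)).trans (hc hs).2) A ⟨Subset.rfl, le_rfl⟩
  have hD : ediam D = ediam A := hmax.prop.2.antisymm (ediam_mono hAD)
  refine ⟨D, ⟨?_, fun D' hDD' heq => ?_⟩, hAD, hD⟩
  · rw [isBounded_iff_ediam_ne_top, hD]; exact hA
  · have := hmax.eq_of_subset (t := D') ⟨hAD.trans hDD'.subset, (heq.trans hD).le⟩ hDD'.subset
    exact hDD'.ne this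

theorem IsCompletion.ediam_ne_top {S C : Set E} (hC : IsCompletion S C) : ediam S ≠ ⊤ := by
  rw [← hC.2.2, ← isBounded_iff_ediam_ne_top]
  exact hC.1.1

/-- Adding p to `S` keeps the diameter, so a completion of the larger set also completes `S`, and is
`C` by uniqueness. -/
theorem IsCompletion.mem_of_forall_edist_le {S C : Set E} (hS : IsSetOfUniqueCompletion S)
    (hC : IsCompletion S C) {p : E} (hp : ∀ s ∈ S, edist p s ≤ ediam S) : p ∈ C := by
  have hins : ediam (insert p S) = ediam S := by
    refine le_antisymm (ediam_le ?_) (ediam_mono (subset_insert _ _))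
    rintro a (rfl | ha) b (rfl | hb)
    · simp
    · exact hp b hb
    · rw [edist_comm]; exact hp a ha
    · exact edist_le_ediam_of_mem ha hb
  obtain ⟨D, hD⟩ := exists_isCompletion (A := insert p S) (by rw [hins]; exact hC.ediam_ne_top)
  rw [hS.unique hC ⟨hD.1, (subset_insert _ _).trans hD.2.1, hD.2.2.trans hins⟩]
  exact hD.2.1 (mem_insert _ _)

theorem IsCompact.ediam_lt_of_forall_dist_lt {A : Set E} (hA : IsCompact A) {d : ℝ} (hd : 0 < d)
    (h : ∀ a ∈ A, ∀ b ∈ A, dist a b < d) : ediam A < ENNReal.ofReal d := by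
  rcases A.eq_empty_or_nonempty with rfl | hne
  · simpa using hd
  obtain ⟨⟨a, b⟩, ⟨ha, hb⟩, hmax⟩ := (hA.prod hA).exists_isMaxOn (hne.prod hne)
    (f := fun p : E × E => dist p.1 p.2) (by fun_prop)
  refine (ediam_le fun x hx y hy => ?_).trans_lt ((ENNReal.ofReal_lt_ofReal_iff hd).mpr (h a ha b hb))
  rw [edist_dist]
  exact ENNReal.ofReal_le_ofReal (hmax (mk_mem_prod hx hy))

/-- A point of `S` close enough to x avoids each of the finitely many closures that x avoids. -/
theorem encard_le_of_mem_closure {ι : Type*} [Finite ι] {X : Type*} [TopologicalSpace X]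
    {S : Set X} {Q : ι → Set X} {k : ℕ∞} (h : ∀ x ∈ S, k ≤ {i | x ∈ Q i}.encard) {x : X}
    (hx : x ∈ closure S) : k ≤ {i | x ∈ closure (Q i)}.encard := by
  have hU : ∀ᶠ y in 𝓝 x, ∀ i, x ∉ closure (Q i) → y ∉ closure (Q i) :=
    eventually_all.mpr fun i => by
      by_cases hi : x ∈ closure (Q i)
      · simp [hi]
      · filter_upwards [isClosed_closure.isOpen_compl.mem_nhds hi] with y hy _ using hy
  obtain ⟨y, hyS, hy⟩ := ((mem_closure_iff_frequently.mp hx).and_eventually hU).exists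
  refine (h y hyS).trans (encard_le_encard fun i hi => ?_)
  by_contra hxi
  exact hy i hxi (subset_closure hi)

/-! ### Area forms and sides of lines -/

variable [NormedSpace ℝ E]

/-- An area form on a real plane: alternating, satisfying Cramer's identity, and nondegenerate. -/
structure IsAreaForm (ω : E →ₗ[ℝ] E →ₗ[ℝ] ℝ) : Prop where
  alt : ∀ a, ω a a = 0
  cramer : ∀ a b c, ω a b • c + ω b c • a + ω c a • b = 0
  exists_smul : ∀ a b, ω a b = 0 → a ≠ 0 → ∃ t : ℝ, b = t • a

theorem IsAreaForm.swap {ω : E →ₗ[ℝ] E →ₗ[ℝ] ℝ} (h : IsAreaForm ω) (a b : E) :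
    ω a b = - ω b a := by
  have := h.alt (a + b)
  simp only [map_add, LinearMap.add_apply, h.alt] at this
  linarith

theorem exists_isAreaForm (hdim : Module.finrank ℝ E = 2) :
    ∃ ω : E →ₗ[ℝ] E →ₗ[ℝ] ℝ, IsAreaForm ω := by
  have : FiniteDimensional ℝ E := Module.finite_of_finrank_pos (by omega)
  let b := Module.finBasisOfFinrankEq ℝ E hdim
  have hrep : ∀ v, v = b.coord 0 v • b 0 + b.coord 1 v • b 1 := fun v => by
    conv_lhs => rw [← b.sum_repr v, Fin.sum_univ_two]
    rfl
  have hext : ∀ v w, b.coord 0 v = b.coord 0 w → b.coord 1 v = b.coord 1 w → v = w := by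
    intro v w h0 h1
    rw [hrep v, hrep w, h0, h1]
  refine ⟨(b.coord 0).smulRight (b.coord 1) - (b.coord 1).smulRight (b.coord 0), ?_, ?_, ?_⟩
  · intro a
    simp only [LinearMap.sub_apply, LinearMap.smulRight_apply, LinearMap.smul_apply, smul_eq_mul]
    ring
  · intro u v w
    apply hext <;>
    · simp only [LinearMap.sub_apply, LinearMap.smulRight_apply, LinearMap.smul_apply, smul_eq_mul,
        map_add, map_smul, map_zero]
      ring
  · intro u v h hu
    simp only [LinearMap.sub_apply, LinearMap.smulRight_apply, LinearMap.smul_apply,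
      smul_eq_mul] at h
    by_cases h0 : b.coord 0 u = 0
    · have h1 : b.coord 1 u ≠ 0 := fun h1 => hu (hext _ _ (by simpa using h0) (by simpa using h1))
      refine ⟨b.coord 1 v / b.coord 1 u, hext _ _ ?_ ?_⟩
      · rw [h0] at h
        have : b.coord 0 v = 0 := by
          have : b.coord 1 u * b.coord 0 v = 0 := by linarith
          exact (mul_eq_zero.mp this).resolve_left h1
        rw [map_smul, h0, this, smul_zero]
      · rw [map_smul, smul_eq_mul]; field_simp
    · refine ⟨b.coord 0 v / b.coord 0 u, hext _ _ ?_ ?_⟩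
      · rw [map_smul, smul_eq_mul]; field_simp
      · rw [map_smul, smul_eq_mul]; field_simp; linarith

theorem continuous_bilinear [FiniteDimensional ℝ E] (ω : E →ₗ[ℝ] E →ₗ[ℝ] ℝ) {X : Type*}
    [TopologicalSpace X] {f g : X → E} (hf : Continuous f) (hg : Continuous g) :
    Continuous fun t => ω (f t) (g t) := by
  let ω' : E →L[ℝ] E →L[ℝ] ℝ :=
    LinearMap.toContinuousLinearMap ((LinearMap.toContinuousLinearMap : (E →ₗ[ℝ] ℝ) ≃ₗ[ℝ] _).toLinearMap ∘ₗ ω)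
  exact (ω'.continuous.comp hf).clm_apply hg

/-- If two points lie weakly on opposite sides of a line, then the segment joining them
meets the line. -/
theorem IsAreaForm.exists_mem_line {ω : E →ₗ[ℝ] E →ₗ[ℝ] ℝ} (h : IsAreaForm ω) {x l y w : E}
    (hl : l ≠ x) (hs : ω (l - x) (y - x) * ω (l - x) (w - x) ≤ 0) :
    ∃ t ∈ Icc (0 : ℝ) 1, ∃ τ : ℝ, x + τ • (l - x) = y + t • (w - y) := by
  obtain ⟨t, ht, h0⟩ : ∃ t ∈ Icc (0 : ℝ) 1,
      ω (l - x) (y - x) + t * (ω (l - x) (w - x) - ω (l - x) (y - x)) = 0 := by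
    set A := ω (l - x) (y - x)
    set B := ω (l - x) (w - x)
    by_cases hAB : A = B
    · have : A = 0 := by rw [← hAB] at hs; nlinarith [mul_self_nonneg A]
      exact ⟨0, by simp, by simp [this]⟩
    · have hne : A - B ≠ 0 := sub_ne_zero.mpr hAB
      have hp : 0 < (A - B) ^ 2 := by positivity
      have e : A / (A - B) = (A * (A - B)) / (A - B) ^ 2 := by field_simp
      refine ⟨A / (A - B), ⟨?_, ?_⟩, by field_simp; ring⟩
      · rw [e]; apply div_nonneg _ hp.le; nlinarith [mul_self_nonneg A]
      · rw [e, div_le_one hp]; nlinarith [mul_self_nonneg B]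
  obtain ⟨τ, hτ⟩ := h.exists_smul (l - x) (y + t • (w - y) - x) (by
    have : y + t • (w - y) - x = (y - x) + t • ((w - x) - (y - x)) := by module
    rw [this, map_add, map_smul, map_sub _ (w - x), smul_eq_mul, h0]) (sub_ne_zero.mpr hl)
  exact ⟨t, ht, τ, by rw [← hτ]; abel⟩

/-! ### Norming functionals, crossing segments and unit hulls -/

theorem apply_le_of_norm_le {φ : StrongDual ℝ E} (hφ : ‖φ‖ ≤ 1) {v : E} {r : ℝ} (hv : ‖v‖ ≤ r) :
    φ v ≤ r := by
  have := φ.le_opNorm v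
  have h2 := le_abs_self (φ v)
  rw [Real.norm_eq_abs] at this
  nlinarith [norm_nonneg v]

/-- Two segments of length at least `1` which are opposite sides of a quadrilateral with diagonals
of length at most `1` share all their norming functionals. -/
theorem norming_of_crossing {x y l w : E} {s t : ℝ} (hs : s ∈ Icc (0 : ℝ) 1)
    (ht : t ∈ Icc (0 : ℝ) 1) (hm : x + s • (l - x) = y + t • (w - y)) (hlw : 1 ≤ ‖l - w‖)
    (hxl : ‖x - l‖ ≤ 1) (hyw : ‖w - y‖ ≤ 1) (hxw : x ≠ w) (hly : l ≠ y) {φ : StrongDual ℝ E}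
    (hφ : ‖φ‖ ≤ 1) (hxy : φ (x - y) = 1) : φ (x - l) = 1 ∧ φ (w - y) = 1 := by
  have e1 : x - y = s • (x - l) + t • (w - y) := by
    linear_combination (norm := module) (1 : ℝ) • hm
  have e2 : l - w = (1 - s) • (l - x) + (1 - t) • (y - w) := by
    linear_combination (norm := module) (1 : ℝ) • hm
  have ha := apply_le_of_norm_le hφ hxl
  have hb := apply_le_of_norm_le hφ hyw
  have h1 : s * φ (x - l) + t * φ (w - y) = 1 := by
    rw [← hxy]; conv_rhs => rw [e1]
    simp only [map_add, map_smul, smul_eq_mul]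
  have h2 : 1 ≤ (1 - s) + (1 - t) := by
    refine hlw.trans ?_
    rw [e2]
    refine (norm_add_le _ _).trans ?_
    rw [norm_smul, norm_smul, Real.norm_of_nonneg (by linarith [hs.2]),
      Real.norm_of_nonneg (by linarith [ht.2]), norm_sub_rev l x, norm_sub_rev y w]
    nlinarith [hs.1, hs.2, ht.1, ht.2]
  -- The functional gives s + t ≥ 1, the side [l, w] gives s + t ≤ 1.
  have hst : s + t = 1 := by
    have : 1 ≤ s + t := by nlinarith [hs.1, ht.1]
    linarith
  have hs0 : 0 < s := by
    refine lt_of_le_of_ne hs.1 fun h0 => hxw ?_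
    have : t = 1 := by linarith
    subst this; subst h0
    simpa using hm
  have ht0 : 0 < t := by
    refine lt_of_le_of_ne ht.1 fun h0 => hly ?_
    have : s = 1 := by linarith
    subst this; subst h0
    simpa using hm
  constructor <;> nlinarith

/-- As `norming_of_crossing`, when the segment `[y, w]` meets the line through `x` and `l` not
beyond `l`. -/
theorem norming_of_line {x y l w : E} {τ t : ℝ} (hτ : τ ≤ 1)
    (ht : t ∈ Icc (0 : ℝ) 1) (hm : x + τ • (l - x) = y + t • (w - y)) (hlw : 1 ≤ ‖l - w‖)
    (hxl : ‖x - l‖ ≤ 1) (hyw : ‖w - y‖ ≤ 1) (hxw : x ≠ w) (hly : l ≠ y) {φ : StrongDual ℝ E}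
    (hφ : ‖φ‖ ≤ 1) (hxy : φ (x - y) = 1) (hpos : 0 < φ (x - l)) :
    φ (x - l) = 1 ∧ φ (w - y) = 1 := by
  refine norming_of_crossing ⟨?_, hτ⟩ ht hm hlw hxl hyw hxw hly hφ hxy
  -- For τ < 0 the functional would exceed 1 on `t • (w - y)`.
  by_contra! hneg
  have e : t • (w - y) = (x - y) + (-τ) • (x - l) := by linear_combination (norm := module) (-1 : ℝ) • hm
  have h1 := congrArg φ e
  simp only [map_add, map_smul, smul_eq_mul] at h1
  have hb := apply_le_of_norm_le hφ hyw
  rw [hxy] at h1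
  nlinarith [ht.1, ht.2, mul_pos (neg_pos.mpr hneg) hpos]

/-- `C` has diameter at most `1` and is the intersection of the unit balls centred at the points of
the compact set `S`. -/
structure IsUnitHull (S C : Set E) : Prop where
  isCompact : IsCompact S
  mem_iff : ∀ p, p ∈ C ↔ ∀ s ∈ S, ‖p - s‖ ≤ 1
  norm_sub_le : ∀ p ∈ C, ∀ q ∈ C, ‖p - q‖ ≤ 1
  subset : S ⊆ C

/-- Otherwise l could be pushed slightly away from z while staying within 1 of `S`, hence in `C`,
but farther than 1 from z. -/
theorem IsUnitHull.exists_one_le_norm_sub {S C : Set E} (h : IsUnitHull S C) {z l : E} (hz : z ∈ C)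
    (hzl : ‖z - l‖ = 1) : ∃ w ∈ S, 1 ≤ ‖l - w‖ := by
  by_contra! hlt
  obtain ⟨M, hM1, hM⟩ : ∃ M < (1 : ℝ), ∀ s ∈ S, ‖l - s‖ ≤ M := by
    rcases S.eq_empty_or_nonempty with rfl | hne
    · exact ⟨0, by norm_num, by simp⟩
    · obtain ⟨s, hs, hmax⟩ := h.isCompact.exists_isMaxOn hne
        (f := fun s => ‖l - s‖) (by fun_prop)
      exact ⟨‖l - s‖, hlt s hs, fun s' hs' => hmax hs'⟩
  have hp : l + (1 - M) • (l - z) ∈ C := by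
    rw [h.mem_iff]
    intro s hs
    have e : l + (1 - M) • (l - z) - s = (l - s) + (1 - M) • (l - z) := by abel
    rw [e]
    refine (norm_add_le _ _).trans ?_
    rw [norm_smul, Real.norm_of_nonneg (by linarith), norm_sub_rev l z, hzl]
    linarith [hM s hs]
  have h1 := h.norm_sub_le _ hp _ hz
  have e : l + (1 - M) • (l - z) - z = (1 + (1 - M)) • (l - z) := by module
  rw [e, norm_smul, Real.norm_of_nonneg (by linarith), norm_sub_rev l z, hzl] at h1
  linarith

/-! ### Partners of a point off `S` -/

theorem exists_norming {v : E} (hv : ‖v‖ = 1) : ∃ φ : StrongDual ℝ E, ‖φ‖ ≤ 1 ∧ φ v = 1 := by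
  obtain ⟨φ, h1, h2⟩ := exists_dual_vector ℝ v (by rw [hv]; norm_num)
  exact ⟨φ, h1.le, by rw [h2, hv]; simp⟩

theorem segment_subset_sphere {φ : StrongDual ℝ E} (hφ : ‖φ‖ ≤ 1) {a b : E} (ha : ‖a‖ ≤ 1)
    (hb : ‖b‖ ≤ 1) (ha1 : φ a = 1) (hb1 : φ b = 1) : segment ℝ a b ⊆ sphere (0 : E) 1 := by
  rintro _ ⟨s, t, hs, ht, hst, rfl⟩
  rw [mem_sphere_zero_iff_norm]
  apply le_antisymm
  · refine (norm_add_le _ _).trans ?_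
    rw [norm_smul, norm_smul, Real.norm_of_nonneg hs, Real.norm_of_nonneg ht]
    nlinarith
  · by_contra! hlt
    have h2 := apply_le_of_norm_le hφ (le_refl ‖s • a + t • b‖)
    simp only [map_add, map_smul, smul_eq_mul, ha1, hb1] at h2
    linarith

/-- The line from x in direction -u weakly separates y₁ from w, so [y₁, w] meets it, and
`norming_of_line` makes a functional norming `x - y₁` norm u too. -/
theorem IsUnitHull.segment_subset_sphere {S C : Set E} (h : IsUnitHull S C)
    {ω : E →ₗ[ℝ] E →ₗ[ℝ] ℝ} (hω : IsAreaForm ω) {x y₁ y₂ u w : E} {κ t : ℝ} (hx : x ∈ C)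
    (hxS : x ∉ S) (hy₁ : y₁ ∈ C) (hy₂ : y₂ ∈ C) (h₁ : ‖x - y₁‖ = 1) (hu : ‖u‖ = 1) (hκ : 0 < κ)
    (ht0 : 0 < t) (ht1 : t < 1) (hut : u = κ • ((1 - t) • (x - y₁) + t • (x - y₂))) (hw : w ∈ S)
    (huw : 1 ≤ ‖x - u - w‖) (hs : ω (-u) (y₁ - x) * ω (-u) (w - x) ≤ 0) :
    segment ℝ (x - y₁) u ⊆ sphere (0 : E) 1 := by
  obtain ⟨φ, hφ, hφ1⟩ := exists_norming h₁
  have hwC := h.subset hw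
  have hu0 : u ≠ 0 := by rw [← norm_pos_iff]; linarith
  by_cases hly : x - u = y₁
  · have : u = x - y₁ := by rw [← hly]; abel
    rw [← this, segment_same]
    simpa using hu
  obtain ⟨r, hr, τ, hm⟩ := hω.exists_mem_line (x := x) (l := x - u) (y := y₁) (w := w)
    (by simpa using hu0) (by rwa [sub_sub_cancel_left])
  have hφ2 : 0 ≤ φ (x - y₂) := by
    have := apply_le_of_norm_le hφ (h.norm_sub_le _ hy₂ _ hy₁)
    have e : x - y₁ = (x - y₂) + (y₂ - y₁) := by abel
    rw [e, map_add] at hφ1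
    linarith
  have hpos : 0 < φ u := by
    rw [hut]
    simp only [map_add, map_smul, smul_eq_mul, hφ1]
    have := mul_nonneg ht0.le hφ2
    apply mul_pos hκ
    linarith
  -- A crossing beyond `x - u` would be a point of [y₁, w] farther than 1 from x, against convexity
  -- of the ball.
  have hτ : τ ≤ 1 := by
    by_contra! hlt
    have e : τ • (-u) = (1 - r) • (y₁ - x) + r • (w - x) := by
      linear_combination (norm := module) (1 : ℝ) • hm
    have h3 : ‖τ • (-u)‖ ≤ 1 := by
      rw [e]
      refine (norm_add_le _ _).trans ?_
      rw [norm_smul, norm_smul, Real.norm_of_nonneg (by linarith [hr.2]),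
        Real.norm_of_nonneg hr.1]
      have := h.norm_sub_le _ hwC _ hx
      have := h.norm_sub_le _ hy₁ _ hx
      nlinarith [hr.1, hr.2]
    rw [norm_smul, norm_neg, hu, Real.norm_of_nonneg (by linarith)] at h3
    linarith
  have key := norming_of_line hτ hr hm huw (by simp [hu]) (h.norm_sub_le _ hwC _ hy₁)
    (fun e => hxS (e ▸ hw)) hly hφ hφ1 (by simpa using hpos)
  refine _root_.segment_subset_sphere hφ h₁.le hu.le hφ1 ?_
  simpa using key.1

theorem IsAreaForm.independent {ω : E →ₗ[ℝ] E →ₗ[ℝ] ℝ} (hω : IsAreaForm ω) {a b : E}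
    (h : ω a b ≠ 0) {s t : ℝ} (h0 : s • a + t • b = 0) : s = 0 ∧ t = 0 := by
  constructor
  · have := congrArg (fun v => ω v b) h0
    simpa [hω.alt, h] using this
  · have := congrArg (fun v => ω a v) h0
    simpa [hω.alt, h] using this

theorem segment_subset_of_segment_subset {a b : E} {A : Set E} {t : ℝ} (ht : t ∈ Icc (0 : ℝ) 1)
    (h₁ : segment ℝ a ((1 - t) • a + t • b) ⊆ A) (h₂ : segment ℝ b ((1 - t) • a + t • b) ⊆ A) :
    segment ℝ a b ⊆ A := by
  rw [segment_eq_image]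
  rintro _ ⟨s, ⟨hs0, hs1⟩, rfl⟩
  rcases le_total s t with hst | hst
  · rcases ht.1.eq_or_lt with rfl | ht0
    · obtain rfl : s = 0 := le_antisymm hst hs0
      exact h₁ (by simp)
    · refine h₁ ⟨1 - s / t, s / t, ?_, by positivity, by ring, ?_⟩
      · rw [sub_nonneg, div_le_one ht0]; exact hst
      · match_scalars <;> field_simp
        ring
  · rcases ht.2.eq_or_lt with rfl | ht1
    · obtain rfl : s = 1 := le_antisymm hs1 hst
      exact h₂ (by simp)
    · have : 0 < 1 - t := sub_pos.mpr ht1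
      refine h₂ ⟨1 - (1 - s) / (1 - t), (1 - s) / (1 - t), ?_, ?_, by ring, ?_⟩
      · rw [sub_nonneg, div_le_one this]; linarith
      · exact div_nonneg (by linarith) this.le
      · match_scalars <;> field_simp
        ring

/-- Each unit direction between the two is joined to one of them inside the sphere, according to the
side on which w falls. Both conditions are closed, so by connectedness some direction is joined to
both; without angles the three are collinear. -/
theorem IsUnitHull.segment_sub_subset_sphere {S C : Set E} (h : IsUnitHull S C)
    (hE : ¬ IsAngled E) {ω : E →ₗ[ℝ] E →ₗ[ℝ] ℝ} (hω : IsAreaForm ω) [FiniteDimensional ℝ E]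
    {x y₁ y₂ : E} (hx : x ∈ C) (hxS : x ∉ S) (hy₁ : y₁ ∈ C) (hy₂ : y₂ ∈ C) (h₁ : ‖x - y₁‖ = 1)
    (h₂ : ‖x - y₂‖ = 1) : segment ℝ (x - y₁) (x - y₂) ⊆ sphere (0 : E) 1 := by
  obtain ⟨u₁, hu₁⟩ : ∃ u, u = x - y₁ := ⟨_, rfl⟩
  obtain ⟨u₂, hu₂⟩ : ∃ u, u = x - y₂ := ⟨_, rfl⟩
  have h₁' := h₁
  have h₂' := h₂
  rw [← hu₁] at h₁
  rw [← hu₂] at h₂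
  have h12 : ‖u₁ - u₂‖ ≤ 1 := by
    have := h.norm_sub_le _ hy₂ _ hy₁
    rwa [hu₁, hu₂, sub_sub_sub_cancel_left]
  rw [← hu₁, ← hu₂]
  by_cases hind : ω u₁ u₂ = 0
  · obtain ⟨c, hc⟩ := hω.exists_smul _ _ hind (by rw [← norm_pos_iff]; linarith)
    rw [hc, norm_smul, h₁, mul_one, Real.norm_eq_abs] at h₂
    rcases (abs_eq zero_le_one).mp h₂ with rfl | rfl
    · rw [hc, one_smul, segment_same]; simpa using h₁
    · exfalso
      rw [hc] at h12
      have : u₁ - (-1 : ℝ) • u₁ = (2 : ℝ) • u₁ := by module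
      rw [this, norm_smul, h₁] at h12
      norm_num at h12
  by_contra hns
  let g : ℝ → E := fun t => (1 - t) • u₁ + t • u₂
  have hg0 : ∀ t, g t ≠ 0 := fun t h0 => by
    obtain ⟨h3, h4⟩ := hω.independent hind h0
    linarith
  let U : ℝ → E := fun t => ‖g t‖⁻¹ • g t
  have hgc : Continuous g := by fun_prop
  have hUc : Continuous U := (hgc.norm.inv₀ fun t => norm_ne_zero_iff.mpr (hg0 t)).smul hgc
  have hU1 : ∀ t, ‖U t‖ = 1 := fun t => by
    rw [norm_smul, norm_inv, norm_norm, inv_mul_cancel₀ (norm_ne_zero_iff.mpr (hg0 t))]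
  have hclosed : ∀ v : E, IsClosed {t | segment ℝ v (U t) ⊆ sphere (0 : E) 1} := by
    intro v
    have : {t | segment ℝ v (U t) ⊆ sphere (0 : E) 1} =
        ⋂ s ∈ Icc (0 : ℝ) 1, {t | ‖v + s • (U t - v)‖ = 1} := by
      ext t
      simp only [segment_eq_image', subset_def, mem_image, mem_sphere_zero_iff_norm, mem_ofPred_eq,
        mem_iInter]
      exact ⟨fun H s hs => H _ ⟨s, hs, rfl⟩, by rintro H _ ⟨s, hs, rfl⟩; exact H s hs⟩
    rw [this]
    refine isClosed_biInter fun s _ => isClosed_eq (by fun_prop) continuous_const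
  have hcover : Icc (0 : ℝ) 1 ⊆ {t | segment ℝ u₁ (U t) ⊆ sphere (0 : E) 1} ∪
      {t | segment ℝ u₂ (U t) ⊆ sphere (0 : E) 1} := by
    rintro t ⟨ht0, ht1⟩
    rcases ht0.eq_or_lt with rfl | ht0
    · left; simp [U, g, h₁]
    rcases ht1.eq_or_lt with rfl | ht1
    · right; simp [U, g, h₂]
    have hκ : 0 < ‖g t‖⁻¹ := inv_pos.mpr (norm_pos_iff.mpr (hg0 t))
    obtain ⟨w, hw, hlw⟩ := h.exists_one_le_norm_sub (l := x - U t) hx (by simp [hU1])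
    have a1 : ω (-U t) (y₁ - x) = - (‖g t‖⁻¹ * t * ω u₁ u₂) := by
      have : y₁ - x = - u₁ := by rw [hu₁]; abel
      rw [this]
      simp only [U, g, map_neg, LinearMap.neg_apply, map_smul, map_add, LinearMap.smul_apply,
        LinearMap.add_apply, hω.alt, smul_eq_mul, hω.swap u₂ u₁]
      ring
    have a2 : ω (-U t) (y₂ - x) = ‖g t‖⁻¹ * (1 - t) * ω u₁ u₂ := by
      have : y₂ - x = - u₂ := by rw [hu₂]; abel
      rw [this]
      simp only [U, g, map_neg, LinearMap.neg_apply, map_smul, map_add, LinearMap.smul_apply,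
        LinearMap.add_apply, hω.alt, smul_eq_mul]
      ring
    rcases le_total 0 (ω u₁ u₂ * ω (-U t) (w - x)) with hs | hs
    · left
      have := h.segment_subset_sphere hω hx hxS hy₁ hy₂ h₁' (hU1 t) hκ ht0 ht1
        (by simp only [U, g, hu₁, hu₂]) hw hlw (by
          rw [a1]
          have := mul_nonneg (mul_pos hκ ht0).le hs
          linarith)
      rwa [← hu₁] at this
    · right
      have := h.segment_subset_sphere hω hx hxS hy₂ hy₁ h₂' (hU1 t) hκ (t := 1 - t) (by linarith)
        (by linarith) (by simp only [U, g, hu₁, hu₂]; module) hw hlw (by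
          rw [a2]
          have := mul_nonpos_of_nonneg_of_nonpos (mul_pos hκ (sub_pos.mpr ht1)).le hs
          linarith)
      rwa [← hu₂] at this
  obtain ⟨t, ht, htF₁, htF₂⟩ := isPreconnected_closed_iff.mp (isPreconnected_Icc (a := (0:ℝ)) (b := 1)) _ _
    (hclosed u₁) (hclosed u₂) hcover ⟨0, by simp, by simp [U, g, h₁]⟩ ⟨1, by simp, by simp [U, g, h₂]⟩
  have hcol : Collinear ℝ {u₁, U t, u₂} := by
    by_contra hcol
    exact hE ⟨u₁, U t, u₂, hcol, union_subset htF₁ (by rw [segment_symm]; exact htF₂)⟩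
  obtain ⟨v, hv⟩ := (collinear_iff_of_mem (p₀ := u₁) (by simp)).mp hcol
  obtain ⟨c, hc⟩ := hv (U t) (by simp)
  obtain ⟨d, hd⟩ := hv u₂ (by simp)
  simp only [vadd_eq_add] at hc hd
  have hrel : d • (U t - u₁) = c • (u₂ - u₁) := by rw [hc, hd]; module
  have hd0 : d ≠ 0 := by
    rintro rfl
    rw [zero_smul, zero_add] at hd
    exact hind (by rw [hd, hω.alt])
  -- Both points lie on the line through u₁ and u₂, which misses the origin, so the radial factor is
  -- 1.
  have hUg : U t = g t := by
    have e : (d * (‖g t‖⁻¹ * (1 - t)) - d + c) • u₁ + (d * (‖g t‖⁻¹ * t) - c) • u₂ = 0 := by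
      simp only [U] at hrel
      linear_combination (norm := skip) (1 : ℝ) • hrel
      simp only [g]
      module
    obtain ⟨h3, h4⟩ := hω.independent hind e
    have : d * (‖g t‖⁻¹ - 1) = 0 := by linarith
    have : ‖g t‖⁻¹ = 1 := by linarith [(mul_eq_zero.mp this).resolve_left hd0]
    simp only [U, this, one_smul]
  apply hns
  rw [mem_ofPred_eq, hUg] at htF₁ htF₂
  exact segment_subset_of_segment_subset ht htF₁ htF₂

/-- A point off `S` has its farthest points of `C` among those of some point of `S`. -/
theorem IsUnitHull.exists_partner_superset {S C : Set E} (h : IsUnitHull S C)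
    (hE : ¬ IsAngled E) {ω : E →ₗ[ℝ] E →ₗ[ℝ] ℝ} (hω : IsAreaForm ω) [FiniteDimensional ℝ E]
    (hS : S.Nonempty) {x : E} (hx : x ∈ C) (hxS : x ∉ S) :
    ∃ x' ∈ S, ∀ y ∈ C, ‖x - y‖ = 1 → ‖x' - y‖ = 1 := by
  by_cases hne : ∃ y ∈ C, ‖x - y‖ = 1
  swap
  · obtain ⟨s, hs⟩ := hS
    exact ⟨s, hs, fun y hy hxy => (hne ⟨y, hy, hxy⟩).elim⟩
  obtain ⟨y₁, hy₁, h₁⟩ := hne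
  have hseg := fun y hy hxy => h.segment_sub_subset_sphere hE hω hx hxS hy₁ (y₂ := y) hy h₁ hxy
  by_cases hne2 : ∃ y ∈ C, ‖x - y‖ = 1 ∧ y ≠ y₁
  swap
  · push Not at hne2
    obtain ⟨w, hw, hwy⟩ := h.exists_one_le_norm_sub hx h₁
    refine ⟨w, hw, fun y hy hxy => ?_⟩
    rw [hne2 y hy hxy, norm_sub_rev]
    exact (h.norm_sub_le _ hy₁ _ (h.subset hw)).antisymm hwy
  obtain ⟨y₂, hy₂, h₂, h12⟩ := hne2
  have hmid : midpoint ℝ (x - y₁) (x - y₂) ∈ segment ℝ (x - y₁) (x - y₂) := midpoint_mem_segment _ _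
  have hmid1 := hseg y₂ hy₂ h₂ hmid
  rw [mem_sphere_zero_iff_norm] at hmid1
  -- Here l is the midpoint of y₁ and y₂. A functional norming its difference with w norms `y₁ - w`
  -- and `y₂ - w`, so it is constant on the line y₁y₂, which contains all partners of x.
  obtain ⟨w, hw, hlw⟩ := h.exists_one_le_norm_sub (l := x - midpoint ℝ (x - y₁) (x - y₂)) hx
    (by simpa using hmid1)
  have hwC := h.subset hw
  have e : x - midpoint ℝ (x - y₁) (x - y₂) - w = (1 / 2 : ℝ) • (y₁ - w) + (1 / 2 : ℝ) • (y₂ - w) := by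
    rw [midpoint_eq_smul_add, invOf_eq_inv]
    module
  obtain ⟨φ, hφ, hφ1⟩ := exists_norming
    (v := x - midpoint ℝ (x - y₁) (x - y₂) - w) (by
      refine le_antisymm ?_ hlw
      rw [e]
      refine (norm_add_le _ _).trans ?_
      rw [norm_smul, norm_smul]
      have := h.norm_sub_le _ hy₁ _ hwC
      have := h.norm_sub_le _ hy₂ _ hwC
      norm_num
      linarith)
  have b₁ := apply_le_of_norm_le hφ (h.norm_sub_le _ hy₁ _ hwC)
  have b₂ := apply_le_of_norm_le hφ (h.norm_sub_le _ hy₂ _ hwC)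
  rw [e, map_add, map_smul, map_smul, smul_eq_mul, smul_eq_mul] at hφ1
  have c₁ : φ (y₁ - w) = 1 := by linarith
  have c₂ : φ (y₂ - w) = 1 := by linarith
  refine ⟨w, hw, fun y hy hxy => ?_⟩
  rw [norm_sub_rev]
  refine (h.norm_sub_le _ hy _ hwC).antisymm ?_
  suffices hφy : φ (y - w) = 1 by
    rw [← hφy]; exact apply_le_of_norm_le hφ le_rfl
  have hcol : Collinear ℝ {x - y₁, x - y₂, x - y} := by
    by_contra hcol
    refine hE ⟨_, _, _, hcol, union_subset (hseg y₂ hy₂ h₂) ?_⟩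
    exact h.segment_sub_subset_sphere hE hω hx hxS hy₂ hy h₂ hxy
  obtain ⟨v, hv⟩ := (collinear_iff_of_mem (p₀ := x - y₁) (by simp)).mp hcol
  obtain ⟨c, hc⟩ := hv (x - y₂) (by simp)
  obtain ⟨d, hd⟩ := hv (x - y) (by simp)
  simp only [vadd_eq_add] at hc hd
  have hc' : y₂ = y₁ - c • v := by linear_combination (norm := module) (-1 : ℝ) • hc
  have hd' : y = y₁ - d • v := by linear_combination (norm := module) (-1 : ℝ) • hd
  have hc0 : c ≠ 0 := by
    rintro rfl
    exact h12 (by simpa using hc')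
  rw [hc'] at c₂
  rw [hd']
  simp only [map_sub, map_smul, smul_eq_mul] at c₁ c₂ ⊢
  have : c * φ v = 0 := by linarith
  rw [(mul_eq_zero.mp this).resolve_left hc0]
  linarith

/-! ### Diametral segments with nearby endpoints -/

/-- The coefficients belong to points x, y, z, v with heights 1, 0, p, q for one functional and p',
q', 1, 0 for another. In every other sign pattern the positive and negative parts cannot balance in
both heights. -/
theorem sign_of_affine_relation_aux {p q p' q' α β γ δ : ℝ} (hq : 0 < q) (hq2 : q < 1 / 2)
    (hp : 1 / 2 < p) (hp1 : p ≤ 1) (hp' : 1 / 2 < p') (hp1' : p' < 1) (hq' : 0 ≤ q')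
    (hq2' : q' < 1 / 2) (hsum : α + β + γ + δ = 0) (h₁ : α + γ * p + δ * q = 0)
    (h₂ : γ + α * p' + β * q' = 0) (hne : ¬ (α = 0 ∧ β = 0 ∧ γ = 0)) (hα : 0 ≤ α) :
    0 < α ∧ 0 < β ∧ γ < 0 := by
  rcases le_total 0 β with hβ | hβ <;> rcases le_total 0 γ with hγ | hγ <;>
    rcases le_total 0 δ with hδ | hδ
  · exact (hne ⟨by linarith, by linarith, by linarith⟩).elim
  · have a1 : 0 ≤ α * p' := by positivity
    have a2 : 0 ≤ β * q' := by positivity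
    have g0 : γ = 0 := by linarith
    have a0 : α = 0 := by nlinarith
    have d0 : δ = 0 := by
      subst g0 a0
      simpa [hq.ne'] using h₁
    exact (hne ⟨by linarith, by linarith, by linarith⟩).elim
  · have a1 : α * (1 - p') ≥ 0 := mul_nonneg hα (by linarith)
    have a2 : β * (1 - q') ≥ 0 := mul_nonneg hβ (by linarith)
    have : α = 0 := by nlinarith
    have : β = 0 := by nlinarith
    exact (hne ⟨by linarith, by linarith, by linarith⟩).elim
  · refine ⟨hα.lt_of_ne' fun h0 => ?_, hβ.lt_of_ne' fun h0 => ?_, hγ.lt_of_ne fun h0 => ?_⟩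
    · subst h0
      have : γ * p ≤ 0 := mul_nonpos_of_nonpos_of_nonneg hγ (by linarith)
      have : δ * q ≤ 0 := mul_nonpos_of_nonpos_of_nonneg hδ (by linarith)
      have : γ = 0 := by nlinarith
      have : δ = 0 := by nlinarith
      exact (hne ⟨by linarith, by linarith, by linarith⟩).elim
    · subst h0
      have : γ * (1 - p) ≤ 0 := mul_nonpos_of_nonpos_of_nonneg hγ (by linarith)
      have : δ = 0 := by nlinarith
      have : α * (1 - p') = 0 := by linarith
      have : α = 0 := (mul_eq_zero.mp this).resolve_right (by linarith)
      exact (hne ⟨by linarith, by linarith, by linarith⟩).elim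
    · subst h0
      have a1 : 0 ≤ β * q' := by positivity
      have : α = 0 := by nlinarith
      have : δ = 0 := by nlinarith
      exact (hne ⟨by linarith, by linarith, by linarith⟩).elim
  · have : 0 ≤ γ * p := mul_nonneg hγ (by linarith)
    have : 0 ≤ δ * q := mul_nonneg hδ (by linarith)
    have : γ = 0 := by nlinarith
    have : δ = 0 := by nlinarith
    exact (hne ⟨by linarith, by linarith, by linarith⟩).elim
  · have a1 : 0 ≤ γ * p := mul_nonneg hγ (by linarith)
    have a2 : 0 ≤ α * p' := mul_nonneg hα (by linarith)
    have a3 : δ * (1 / 2 - q) ≤ 0 := mul_nonpos_of_nonpos_of_nonneg hδ (by linarith)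
    have a4 : β * (1 / 2 - q') ≤ 0 := mul_nonpos_of_nonpos_of_nonneg hβ (by linarith)
    have : α = 0 := by linarith
    have : γ = 0 := by linarith
    have : δ * q = 0 := by subst_vars; linarith
    have : δ = 0 := (mul_eq_zero.mp this).resolve_right (by linarith)
    exact (hne ⟨by linarith, by linarith, by linarith⟩).elim
  · have a1 : γ * (1 - p) ≤ 0 := mul_nonpos_of_nonpos_of_nonneg hγ (by linarith)
    have a2 : 0 ≤ δ * q := mul_nonneg hδ (by linarith)
    have a3 : β * q' ≤ 0 := mul_nonpos_of_nonpos_of_nonneg hβ (by linarith)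
    have a4 : 0 ≤ α * (1 - p') := mul_nonneg hα (by linarith)
    have : α * (1 - p') = 0 := by linarith
    have : α = 0 := (mul_eq_zero.mp this).resolve_right (by linarith)
    have : δ * q = 0 := by linarith
    have : δ = 0 := (mul_eq_zero.mp this).resolve_right (by linarith)
    exact (hne ⟨by linarith, by linarith, by linarith⟩).elim
  · have a1 : γ * (1 - p) ≤ 0 := mul_nonpos_of_nonpos_of_nonneg hγ (by linarith)
    have a2 : δ * (1 - q) ≤ 0 := mul_nonpos_of_nonpos_of_nonneg hδ (by linarith)
    have : β = 0 := by linarith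
    have : δ * (1 - q) = 0 := by linarith
    have : δ = 0 := (mul_eq_zero.mp this).resolve_right (by linarith)
    have : α * (1 - p') = 0 := by subst_vars; linarith
    have : α = 0 := (mul_eq_zero.mp this).resolve_right (by linarith)
    exact (hne ⟨by linarith, by linarith, by linarith⟩).elim

/-- Two segments `[x, y]` and `[z, v]` of length `1` with nearby endpoints must cross, which is
expressed by the signs of the coefficients of an affine relation. -/
theorem sign_of_affine_relation {x y z v : E} (hxy : ‖x - y‖ = 1) (hzv : ‖z - v‖ = 1)
    (hxv : ‖x - v‖ < 1) (hyz : ‖z - y‖ ≤ 1) (hxz : ‖z - x‖ < 1 / 2) (hyv : ‖v - y‖ < 1 / 2)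
    {α β γ δ : ℝ} (hsum : α + β + γ + δ = 0) (hrel : α • x + β • y + γ • z + δ • v = 0)
    (hne : ¬ (α = 0 ∧ β = 0 ∧ γ = 0)) : 0 < α * β ∧ β * γ < 0 := by
  obtain ⟨φ, hφ, hφ1⟩ := exists_norming hxy
  obtain ⟨ψ, hψ, hψ1⟩ := exists_norming hzv
  have hδ : δ = -(α + β + γ) := by linarith
  have h₁ : α + γ * φ (z - y) + δ * φ (v - y) = 0 := by
    have e : α • (x - y) + γ • (z - y) + δ • (v - y) = 0 := by
      rw [← hrel, hδ]; module
    have := congrArg φ e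
    simpa only [map_add, map_smul, smul_eq_mul, hφ1, mul_one, map_zero] using this
  have h₂ : γ + α * ψ (x - v) + β * ψ (y - v) = 0 := by
    have e : γ • (z - v) + α • (x - v) + β • (y - v) = 0 := by
      rw [← hrel, hδ]; module
    have := congrArg ψ e
    simpa only [map_add, map_smul, smul_eq_mul, hψ1, mul_one, map_zero] using this
  have lt_of {θ : StrongDual ℝ E} (hθ : ‖θ‖ ≤ 1) {u : E} {r : ℝ} (hu : ‖u‖ < r) : θ u < r :=
    (apply_le_of_norm_le hθ le_rfl).trans_lt hu
  have c1 : φ (x - v) < 1 := lt_of hφ hxv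
  have c2 : φ (v - y) < 1 / 2 := lt_of hφ hyv
  have c3 : φ (x - z) < 1 / 2 := lt_of hφ (by rwa [norm_sub_rev])
  have c4 : φ (z - y) ≤ 1 := apply_le_of_norm_le hφ hyz
  have d1 : ψ (x - v) < 1 := lt_of hψ hxv
  have d2 : ψ (y - v) < 1 / 2 := lt_of hψ (by rwa [norm_sub_rev])
  have d3 : ψ (z - x) < 1 / 2 := lt_of hψ hxz
  have d4 : ψ (z - y) ≤ 1 := apply_le_of_norm_le hψ hyz
  have hq : 0 < φ (v - y) := by simp only [map_sub] at *; linarith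
  have hp : 1 / 2 < φ (z - y) := by simp only [map_sub] at *; linarith
  have hp' : 1 / 2 < ψ (x - v) := by simp only [map_sub] at *; linarith
  have hq' : 0 ≤ ψ (y - v) := by simp only [map_sub] at *; linarith
  rcases le_total 0 α with hα | hα
  · obtain ⟨a, b, c⟩ := sign_of_affine_relation_aux hq c2 hp c4 hp' d1 hq' d2 hsum h₁ h₂ hne hα
    exact ⟨mul_pos a b, mul_neg_of_pos_of_neg b c⟩
  · obtain ⟨a, b, c⟩ := sign_of_affine_relation_aux hq c2 hp c4 hp' d1 hq' d2
      (α := -α) (β := -β) (γ := -γ) (δ := -δ) (by linarith) (by linarith) (by linarith)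
      (by simpa using hne) (by linarith)
    exact ⟨mul_pos_of_neg_of_neg (by linarith) (by linarith),
      mul_neg_of_neg_of_pos (by linarith) (by linarith)⟩

/-- By Cramer's identity these areas are the coefficients of an affine relation between x, y, z, v.
-/
theorem IsAreaForm.sign_of_crossing {ω : E →ₗ[ℝ] E →ₗ[ℝ] ℝ} (hω : IsAreaForm ω) {x y z v : E}
    (hxy : ‖x - y‖ = 1) (hzv : ‖z - v‖ = 1)
    (hxv : ‖x - v‖ < 1) (hyz : ‖z - y‖ ≤ 1) (hxz : ‖z - x‖ < 1 / 2) (hyv : ‖v - y‖ < 1 / 2) :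
    0 < ω (y - v) (z - v) * ω (z - v) (x - v) ∧ ω (z - v) (x - v) * ω (x - v) (y - v) < 0 := by
  have key {α β γ δ : ℝ} := sign_of_affine_relation hxy hzv hxv hyz hxz hyv
    (α := α) (β := β) (γ := γ) (δ := δ)
  have hγ : ω (x - v) (y - v) ≠ 0 := by
    intro h0
    have hne : x - v ≠ 0 := by
      intro h
      rw [sub_eq_zero.mp h] at hxy
      linarith
    obtain ⟨t, ht⟩ := hω.exists_smul _ _ h0 hne
    have := (key (α := t) (β := -1) (γ := 0) (δ := 1 - t) (by ring)
      (by linear_combination (norm := module) (-1 : ℝ) • ht) (by simp)).2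
    simp at this
  refine key (δ := -(ω (y - v) (z - v) + ω (z - v) (x - v) + ω (x - v) (y - v))) (by ring) ?_ ?_
  · rw [← hω.cramer (x - v) (y - v) (z - v)]
    module
  · exact fun h => hγ h.2.2

/-- The point l is v turned slightly about z towards y. The last two inequalities put v and x on one
side of the line zl, and y and z on one side of the line xl. -/
theorem IsAreaForm.exists_between {ω : E →ₗ[ℝ] E →ₗ[ℝ] ℝ} [FiniteDimensional ℝ E]
    (hω : IsAreaForm ω) {x y z v : E} (hzv : ‖z - v‖ = 1)
    (h₁ : 0 < ω (y - v) (z - v) * ω (z - v) (x - v))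
    (h₂ : ω (z - v) (x - v) * ω (x - v) (y - v) < 0) {η : ℝ} (hη : 0 < η) :
    ∃ l, ‖z - l‖ = 1 ∧ ‖l - v‖ < η ∧ 0 < ω (l - z) (v - z) * ω (l - z) (x - z) ∧
      0 < ω (l - x) (y - x) * ω (l - x) (z - x) := by
  let g : ℝ → E := fun t => (1 - t) • (z - v) + t • (z - y)
  have hα : ω (y - v) (z - v) ≠ 0 := fun h0 => by rw [h0, zero_mul] at h₁; exact h₁.false
  have hgz : ∀ t, ω (g t) (z - v) = - t * ω (y - v) (z - v) := fun t => by
    have : g t = (z - v) + (-t) • (y - v) := by simp only [g]; module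
    rw [this, map_add, map_smul, LinearMap.add_apply, hω.alt, LinearMap.smul_apply, smul_eq_mul]
    ring
  have hg0 : ∀ t, g t ≠ 0 := fun t h0 => by
    have := hgz t
    rw [h0, map_zero, LinearMap.zero_apply, zero_eq_mul] at this
    have ht : t = 0 := neg_eq_zero.mp (this.resolve_right hα)
    subst ht
    simp only [g, sub_zero, one_smul, zero_smul, add_zero] at h0
    simp [h0] at hzv
  let l : ℝ → E := fun t => z - ‖g t‖⁻¹ • g t
  have hgc : Continuous g := by fun_prop
  have hlc : Continuous l := continuous_const.sub
    ((hgc.norm.inv₀ fun t => norm_ne_zero_iff.mpr (hg0 t)).smul hgc)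
  have hl0 : l 0 = v := by simp [l, g, hzv]
  have E1 : ∀ᶠ t in 𝓝[>] (0 : ℝ), ‖l t - v‖ < η := by
    have : ContinuousAt (fun t => ‖l t - v‖) 0 := by fun_prop
    refine (this.eventually_lt_const ?_).filter_mono nhdsWithin_le_nhds
    simpa [hl0] using hη
  have E2 : ∀ᶠ t in 𝓝[>] (0 : ℝ), 0 < ω (l t - z) (x - z) * -ω (y - v) (z - v) := by
    have : ContinuousAt (fun t => ω (l t - z) (x - z) * -ω (y - v) (z - v)) 0 :=
      ((continuous_bilinear ω (by fun_prop) (by fun_prop)).mul continuous_const).continuousAt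
    refine (this.eventually_const_lt ?_).filter_mono nhdsWithin_le_nhds
    have e : ω (v - z) (x - z) = - ω (z - v) (x - v) := by
      have : x - z = (x - v) - (z - v) := by abel
      rw [this, ← neg_sub z v, map_sub, map_neg, LinearMap.neg_apply, LinearMap.neg_apply, hω.alt]
      ring
    beta_reduce
    rw [hl0, e]
    linarith
  have E3 : ∀ᶠ t in 𝓝[>] (0 : ℝ), 0 < ω (l t - x) (y - x) * ω (l t - x) (z - x) := by
    have : ContinuousAt (fun t => ω (l t - x) (y - x) * ω (l t - x) (z - x)) 0 :=
      ((continuous_bilinear ω (by fun_prop) (by fun_prop)).mul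
        (continuous_bilinear ω (by fun_prop) (by fun_prop))).continuousAt
    refine (this.eventually_const_lt ?_).filter_mono nhdsWithin_le_nhds
    have e1 : ω (v - x) (y - x) = - ω (x - v) (y - v) := by
      have : y - x = (y - v) - (x - v) := by abel
      rw [this, ← neg_sub x v, map_sub, map_neg, LinearMap.neg_apply, LinearMap.neg_apply, hω.alt]
      ring
    have e2 : ω (v - x) (z - x) = ω (z - v) (x - v) := by
      have : z - x = (z - v) - (x - v) := by abel
      rw [this, ← neg_sub x v, map_sub, map_neg, LinearMap.neg_apply, LinearMap.neg_apply, hω.alt,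
        hω.swap (x - v)]
      ring
    beta_reduce
    rw [hl0, e1, e2]
    linarith
  obtain ⟨t, ht1, ht2, ht3, ht0⟩ := (E1.and (E2.and (E3.and self_mem_nhdsWithin))).exists
  have ht0 : 0 < t := ht0
  have hκ : 0 < ‖g t‖⁻¹ := inv_pos.mpr (norm_pos_iff.mpr (hg0 t))
  refine ⟨l t, ?_, ht1, ?_, ht3⟩
  · simp only [l, sub_sub_cancel]
    rw [norm_smul, norm_inv, norm_norm, inv_mul_cancel₀ (norm_ne_zero_iff.mpr (hg0 t))]
  · have e : ω (l t - z) (v - z) = ‖g t‖⁻¹ * t * -ω (y - v) (z - v) := by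
      have : l t - z = - (‖g t‖⁻¹ • g t) := by simp only [l]; abel
      rw [this, ← neg_sub z v, map_neg, map_neg, LinearMap.neg_apply, neg_neg, map_smul,
        LinearMap.smul_apply, hgz, smul_eq_mul]
      ring
    rw [e]
    have := mul_pos (mul_pos hκ ht0) ht2
    linarith

/-- A point `w` of the thin cone with apex `l` spanned by the nearby points `x` and `z`, at distance
about `1` from `l`, is close to `x`. -/
theorem IsAreaForm.norm_sub_le_of_mem_cone {ω : E →ₗ[ℝ] E →ₗ[ℝ] ℝ} (hω : IsAreaForm ω)
    {x z l w : E} {k k' η : ℝ} (hη2 : η < 1 / 2) (hzl : ‖z - l‖ = 1) (hxl : ‖x - l‖ ≤ 1)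
    (hzx : ‖z - x‖ < η) (hlw : 1 ≤ ‖l - w‖) (hwl : ‖w - l‖ ≤ 1 + η)
    (f₁ : 0 < k * ω (l - z) (x - z)) (c₁ : 0 < k * ω (l - z) (w - z))
    (f₂ : 0 < k' * ω (l - x) (z - x)) (c₂ : 0 < k' * ω (l - x) (w - x)) : ‖w - x‖ ≤ 6 * η := by
  have hη0 : 0 < η := (norm_nonneg _).trans_lt hzx
  obtain ⟨θ, hθ, hθ1⟩ := exists_norming hzl
  have hθx : 1 - η < θ (x - l) := by
    have e : x - l = (z - l) - (z - x) := by abel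
    have := apply_le_of_norm_le hθ (le_refl ‖z - x‖)
    rw [e, map_sub, hθ1]
    linarith
  obtain ⟨a, ha⟩ : ∃ a, a = x - l := ⟨_, rfl⟩
  obtain ⟨b, hb⟩ : ∃ b, b = z - l := ⟨_, rfl⟩
  obtain ⟨c, hc⟩ : ∃ c, c = w - l := ⟨_, rfl⟩
  have g₁ : ω (l - z) (x - z) = ω a b := by
    rw [show l - z = -b by rw [hb]; abel, show x - z = a - b by rw [ha, hb]; abel, map_neg,
      LinearMap.neg_apply, map_sub, hω.alt, hω.swap b a]
    ring
  have g₂ : ω (l - z) (w - z) = ω c b := by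
    rw [show l - z = -b by rw [hb]; abel, show w - z = c - b by rw [hc, hb]; abel, map_neg,
      LinearMap.neg_apply, map_sub, hω.alt, hω.swap b c]
    ring
  have g₃ : ω (l - x) (w - x) = - ω a c := by
    rw [show l - x = -a by rw [ha]; abel, show w - x = c - a by rw [hc, ha]; abel, map_neg,
      LinearMap.neg_apply, map_sub, hω.alt]
    ring
  have g₄ : ω (l - x) (z - x) = - ω a b := by
    rw [show l - x = -a by rw [ha]; abel, show z - x = b - a by rw [hb, ha]; abel, map_neg,
      LinearMap.neg_apply, map_sub, hω.alt]
    ring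
  rw [g₁] at f₁
  rw [g₂] at c₁
  rw [g₃] at c₂
  rw [g₄] at f₂
  have pos_div {k P D : ℝ} (h1 : 0 < k * P) (h2 : 0 < k * D) : 0 < P / D := by
    rcases lt_trichotomy k 0 with hk | rfl | hk
    · exact div_pos_of_neg_of_neg (by nlinarith) (by nlinarith)
    · simp at h1
    · exact div_pos (by nlinarith) (by nlinarith)
  have hp := pos_div c₁ f₁
  have hq : 0 < ω a c / ω a b := by
    have := pos_div c₂ f₂
    rwa [neg_div_neg_eq] at this
  have hD : ω a b ≠ 0 := by
    intro h0
    rw [h0, mul_zero] at f₁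
    exact f₁.false
  obtain ⟨p, hpd⟩ : ∃ p, p = ω c b / ω a b := ⟨_, rfl⟩
  obtain ⟨q, hqd⟩ : ∃ q, q = ω a c / ω a b := ⟨_, rfl⟩
  rw [← hpd] at hp
  rw [← hqd] at hq
  have hcpq : c = p • a + q • b := by
    have hcr := hω.cramer a b c
    have : ω a b • c = ω a b • (p • a + q • b) := by
      rw [smul_add, smul_smul, smul_smul, hpd, hqd, mul_div_cancel₀ _ hD, mul_div_cancel₀ _ hD]
      rw [hω.swap b c, hω.swap c a] at hcr
      linear_combination (norm := module) (1 : ℝ) • hcr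
    exact smul_right_injective E hD this
  have b1 : p * θ a + q ≤ 1 + η := by
    have e := congrArg θ hcpq
    simp only [map_add, map_smul, smul_eq_mul] at e
    rw [hb, hθ1, mul_one] at e
    rw [← e, hc]
    exact apply_le_of_norm_le hθ hwl
  have b2 : 1 ≤ p + q := by
    rw [norm_sub_rev, ← hc, hcpq] at hlw
    refine hlw.trans ((norm_add_le _ _).trans ?_)
    rw [norm_smul, norm_smul, Real.norm_of_nonneg hp.le, Real.norm_of_nonneg hq.le, hb, hzl, ha]
    have := mul_le_mul_of_nonneg_left hxl hp.le
    linarith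
  rw [← ha] at hθx
  have b3 : p * (1 - η) ≤ p * θ a := mul_le_mul_of_nonneg_left hθx.le hp.le
  -- As η < 1/2, `b1` bounds p by (1 + η)/(1 - η) < 3; the final bound is then 4η + 2η.
  have b4 : p ≤ 3 := by nlinarith
  have b5 : p + q ≤ 1 + 4 * η := by nlinarith
  have b6 : q ≤ 2 := by nlinarith
  have e : w - x = (p + q - 1) • (x - l) + q • (z - x) := by
    rw [ha, hb, hc] at hcpq
    linear_combination (norm := module) (1 : ℝ) • hcpq
  rw [e]
  refine (norm_add_le _ _).trans ?_
  rw [norm_smul, norm_smul, Real.norm_of_nonneg (by linarith), Real.norm_of_nonneg hq.le]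
  have k₁ : (p + q - 1) * ‖x - l‖ ≤ (p + q - 1) * 1 :=
    mul_le_mul_of_nonneg_left hxl (by linarith)
  have k₂ : q * ‖z - x‖ ≤ 2 * η := mul_le_mul b6 hzx.le (norm_nonneg _) (by norm_num)
  linarith

/-- Two diametral segments `[x, y]` and `[z, v]` of `C` with nearby endpoints `x` and `z`, away from
`S`: if `x` and `v` are not diametral, then there is a segment from `z` to a point of `S` which,
together with `v`, spans a triangle normed by a single functional. -/
theorem IsUnitHull.exists_norming_pair {S C : Set E} (h : IsUnitHull S C)
    {ω : E →ₗ[ℝ] E →ₗ[ℝ] ℝ} (hω : IsAreaForm ω) [FiniteDimensional ℝ E] {x y z v : E}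
    (hx : x ∈ C) (hy : y ∈ C) (hz : z ∈ C) (hv : v ∈ C) (hxS : x ∉ S) (hzS : z ∉ S)
    (hxy : ‖x - y‖ = 1) (hzv : ‖z - v‖ = 1) (hxv : ‖x - v‖ ≠ 1) {η : ℝ} (hη2 : η < 1 / 2)
    (hη : ∀ s ∈ S, 6 * η < ‖s - x‖) (hzx : ‖z - x‖ < η) (hvy : ‖v - y‖ < η) :
    ∃ w ∈ S, ∃ φ : StrongDual ℝ E, ‖φ‖ ≤ 1 ∧ φ (z - v) = 1 ∧ φ (w - v) = 1 := by
  have hη0 : 0 < η := (norm_nonneg _).trans_lt hzx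
  replace hxv : ‖x - v‖ < 1 := (h.norm_sub_le _ hx _ hv).lt_of_ne hxv
  have le_of {θ : StrongDual ℝ E} (hθ : ‖θ‖ ≤ 1) (u : E) : θ u ≤ ‖u‖ :=
    apply_le_of_norm_le hθ le_rfl
  obtain ⟨s₁, s₂⟩ := hω.sign_of_crossing hxy hzv hxv (h.norm_sub_le _ hz _ hy)
    (hzx.trans hη2) (hvy.trans hη2)
  obtain ⟨l, hzl, hlv, f₁, f₂⟩ := hω.exists_between hzv s₁ s₂
    (lt_min hη0 (sub_pos.mpr hxv))
  rw [lt_min_iff] at hlv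
  obtain ⟨hlv, hlv'⟩ := hlv
  have hxl : ‖x - l‖ < 1 := by
    have := norm_sub_le_norm_sub_add_norm_sub x v l
    rw [norm_sub_rev v l] at this
    linarith
  have hly : ‖l - y‖ < 1 := by
    have := norm_sub_le_norm_sub_add_norm_sub l v y
    linarith
  obtain ⟨w, hw, hlw⟩ := h.exists_one_le_norm_sub hz hzl
  have hwC := h.subset hw
  obtain ⟨φ, hφ, hφ1⟩ := exists_norming hzv
  obtain ⟨θ, hθ, hθ1⟩ := exists_norming hzl
  have hθx : 1 - η < θ (x - l) := by
    have := le_of hθ (z - x)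
    have e : x - l = (z - l) - (z - x) := by abel
    rw [e, map_sub, hθ1]
    linarith
  -- If the line zl separates w from v, crossing segments give the claim.
  rcases le_or_gt (ω (l - z) (v - z) * ω (l - z) (w - z)) 0 with c₁ | c₁
  · have hlz : l ≠ z := by rintro rfl; simp at hzl
    obtain ⟨r, hr, τ, hm⟩ := hω.exists_mem_line hlz c₁
    have hτ : τ ≤ 1 := by
      by_contra! hlt
      have e : τ • (l - z) = (1 - r) • (v - z) + r • (w - z) := by
        linear_combination (norm := module) (1 : ℝ) • hm
      have h3 : ‖τ • (l - z)‖ ≤ 1 := by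
        rw [e]
        refine (norm_add_le _ _).trans ?_
        rw [norm_smul, norm_smul, Real.norm_of_nonneg (by linarith [hr.2]),
          Real.norm_of_nonneg hr.1]
        have := h.norm_sub_le _ hwC _ hz
        have := h.norm_sub_le _ hv _ hz
        nlinarith [hr.1, hr.2]
      rw [norm_smul, norm_sub_rev, hzl, Real.norm_of_nonneg (by linarith)] at h3
      linarith
    have hpos : 0 < φ (z - l) := by
      have := le_of hφ (l - v)
      have e : z - l = (z - v) - (l - v) := by abel
      rw [e, map_sub, hφ1]
      linarith
    have hne : l ≠ v := by
      rintro rfl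
      rw [hω.alt, zero_mul] at f₁
      exact f₁.false
    exact ⟨w, hw, φ, hφ, hφ1, (norming_of_line hτ hr hm hlw hzl.le (h.norm_sub_le _ hwC _ hv)
      (fun e => hzS (e ▸ hw)) hne hφ hφ1 hpos).2⟩
  -- Now w is on the side of v and x. Separated from y by the line xl, it would force ‖x - l‖ ≥ 1;
  -- otherwise it lies in the cone at l over x and z, too close to x.
  exfalso
  rcases le_or_gt (ω (l - x) (y - x) * ω (l - x) (w - x)) 0 with c₂ | c₂
  · obtain ⟨ψ, hψ, hψ1⟩ := exists_norming hxy
    have hlx : l ≠ x := by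
      rintro rfl
      simp at f₂
    obtain ⟨r, hr, τ, hm⟩ := hω.exists_mem_line hlx c₂
    have hτ : τ ≤ 1 := by
      by_contra! hlt
      have e : (z - l) + (τ - 1) • (x - l) = (1 - r) • (z - y) + r • (z - w) := by
        linear_combination (norm := module) (-1 : ℝ) • hm
      have e' := congrArg θ e
      simp only [map_add, map_smul, smul_eq_mul, hθ1] at e'
      have a1 := apply_le_of_norm_le hθ (h.norm_sub_le _ hz _ hy)
      have a2 := apply_le_of_norm_le hθ (h.norm_sub_le _ hz _ hwC)
      have : 0 < (τ - 1) * θ (x - l) := mul_pos (by linarith) (by linarith)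
      nlinarith [hr.1, hr.2]
    have hpos : 0 < ψ (x - l) := by
      have := le_of hψ (l - y)
      have e : x - l = (x - y) - (l - y) := by abel
      rw [e, map_sub, hψ1]
      linarith
    have hne : l ≠ y := by rintro rfl; linarith
    have := (norming_of_line hτ hr hm hlw hxl.le (h.norm_sub_le _ hwC _ hy)
      (fun e => hxS (e ▸ hw)) hne hψ hψ1 hpos).1
    linarith [le_of hψ (x - l)]
  · have hwl : ‖w - l‖ ≤ 1 + η := by
      rw [show w - l = (w - v) - (l - v) by abel]
      refine (_root_.norm_sub_le _ _).trans ?_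
      have := h.norm_sub_le _ hwC _ hv
      linarith
    have := hω.norm_sub_le_of_mem_cone hη2 hzl hxl.le hzx hlw hwl f₁ c₁ f₂ c₂
    linarith [hη w hw]

/-- If the triangles `x, w, y` and `z, w', v` are close, and each has two sides normed by a
functional, then the functional of the second one takes its maximum at `x`. -/
theorem IsAreaForm.norming_eq_of_close {ω : E →ₗ[ℝ] E →ₗ[ℝ] ℝ} (hω : IsAreaForm ω) {C : Set E}
    (hC : ∀ p ∈ C, ∀ q ∈ C, ‖p - q‖ ≤ 1) {x w y z w' v : E} (hx : x ∈ C) (hw : w ∈ C)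
    (hy : y ∈ C) (hz : z ∈ C) (hw' : w' ∈ C) (hv : v ∈ C) {φ ψ : StrongDual ℝ E} (hφ : ‖φ‖ ≤ 1)
    (hψ : ‖ψ‖ ≤ 1) (hψx : ψ (x - y) = 1) (hψw : ψ (w - y) = 1) (hφz : φ (z - v) = 1)
    (hφw : φ (w' - v) = 1) (hclose : ‖x - z‖ + ‖w - w'‖ < ‖w - x‖)
    (hK : 0 < ω (w - x) (x - y) * ω (w' - z) (z - v)) : φ (x - v) = 1 := by
  have hle {θ : StrongDual ℝ E} (hθ : ‖θ‖ ≤ 1) {a b : E} (ha : a ∈ C) (hb : b ∈ C) :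
    θ (a - b) ≤ 1 := apply_le_of_norm_le hθ (hC a ha b hb)
  refine (hle hφ hx hv).antisymm ?_
  by_contra! hlt
  -- A functional vanishing on e is proportional to the area against e.
  have repr {θ : StrongDual ℝ E} {e u : E} (he : θ e = 0) (hu : θ u = 1) (a : E) :
      ω e a = ω e u * θ a := by
    have := congrArg θ (hω.cramer e u a)
    simp only [map_add, map_smul, smul_eq_mul, he, hu, map_zero, hω.swap a e] at this
    linarith
  have r₁ := repr (θ := ψ) (e := w - x) (u := x - y)
    (by rw [show w - x = (w - y) - (x - y) by abel, map_sub, hψx, hψw, sub_self]) hψx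
  have r₂ := repr (θ := φ) (e := w' - z) (u := z - v)
    (by rw [show w' - z = (w' - v) - (z - v) by abel, map_sub, hφz, hφw, sub_self]) hφz
  obtain ⟨K, hKd⟩ : ∃ K, K = ω (w - x) (x - y) := ⟨_, rfl⟩
  obtain ⟨K', hKd'⟩ : ∃ K, K = ω (w' - z) (z - v) := ⟨_, rfl⟩
  rw [← hKd] at r₁ hK
  rw [← hKd'] at r₂ hK
  -- On `C`, ψ is largest at x and w, and φ at z and w'.
  have hp : 0 ≤ ψ (x - z) := by
    have := hle hψ hz hy
    rw [show x - z = (x - y) - (z - y) by abel, map_sub]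
    linarith
  have hq : 0 ≤ ψ (w - w') := by
    have := hle hψ hw' hy
    rw [show w - w' = (w - y) - (w' - y) by abel, map_sub]
    linarith
  have hp' : φ (x - z) < 0 := by
    rw [show x - z = (x - v) - (z - v) by abel, map_sub]
    linarith
  have hq' : φ (w - w') ≤ 0 := by
    have := hle hφ hw hv
    rw [show w - w' = (w - v) - (w' - v) by abel, map_sub]
    linarith
  obtain ⟨p, hpd⟩ : ∃ p, p = x - z := ⟨_, rfl⟩
  obtain ⟨q, hqd⟩ : ∃ q, q = w - w' := ⟨_, rfl⟩
  have hd : w' - z = (w - x) + p - q := by rw [hpd, hqd]; abel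
  rw [← hpd] at hp hp' hclose
  rw [← hqd] at hq hq' hclose
  have i₁ := r₂ p
  have i₂ := r₂ q
  rw [hd] at i₁ i₂
  simp only [map_add, LinearMap.add_apply, map_sub, LinearMap.sub_apply, hω.alt] at i₁ i₂
  have j₁ := r₁ p
  have j₂ := r₁ q
  simp only [map_sub, LinearMap.sub_apply] at j₁ j₂
  have hK0 : K ≠ 0 := by rintro rfl; simp at hK
  obtain ⟨c, hc⟩ : ∃ c, c = K' / K := ⟨_, rfl⟩
  have hc0 : 0 < c := by
    have : c = K * K' / K ^ 2 := by rw [hc]; field_simp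
    rw [this]; positivity
  have hK' : K' = c * K := by rw [hc]; field_simp
  obtain ⟨W, hW⟩ : ∃ W, W = ω q p / K := ⟨_, rfl⟩
  have hWK : ω q p = K * W := by rw [hW]; field_simp
  have hW₁ : W = ψ p - c * φ p := by
    apply mul_left_cancel₀ hK0
    rw [← hWK]
    rw [hK'] at i₁
    linarith
  have hW₂ : W = ψ q - c * φ q := by
    apply mul_left_cancel₀ hK0
    rw [← hWK]
    rw [hK', hω.swap p q] at i₂
    linarith
  have hcp : c * φ p < 0 := mul_neg_of_pos_of_neg hc0 hp'
  have hcq : c * φ q ≤ 0 := mul_nonpos_of_nonneg_of_nonpos hc0.le hq'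
  -- W is at least ψ p and ψ q, so this identity bounds ‖w - x‖ by ‖p‖ + ‖q‖, against `hclose`.
  have he : W • (w - x) = ψ p • q - ψ q • p := by
    have := hω.cramer (w - x) q p
    rw [r₁ q, hω.swap p, r₁ p, hWK] at this
    apply smul_right_injective E hK0
    linear_combination (norm := module) (1 : ℝ) • this
  have hn := congrArg norm he
  rw [norm_smul, Real.norm_of_nonneg (by linarith)] at hn
  have hn2 := norm_sub_le (ψ p • q) (ψ q • p)
  rw [norm_smul, norm_smul, Real.norm_of_nonneg hp, Real.norm_of_nonneg hq] at hn2
  have hWpos : 0 < W := by linarith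
  have k₁ : ψ p * ‖q‖ ≤ W * ‖q‖ := mul_le_mul_of_nonneg_right (by linarith) (norm_nonneg _)
  have k₂ : ψ q * ‖p‖ ≤ W * ‖p‖ := mul_le_mul_of_nonneg_right (by linarith) (norm_nonneg _)
  have k₃ := mul_lt_mul_of_pos_left hclose hWpos
  linarith

/-! ### Partners of nearby points and the extended covering -/

theorem IsUnitHull.isCompact_hull {S C : Set E} (h : IsUnitHull S C) [FiniteDimensional ℝ E] :
    IsCompact C := by
  have : ProperSpace E := FiniteDimensional.proper_real E
  refine isCompact_of_isClosed_isBounded ?_ ?_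
  · have : C = ⋂ s ∈ S, {p | ‖p - s‖ ≤ 1} := by
      ext p
      simp [h.mem_iff]
    rw [this]
    exact isClosed_biInter fun s _ => isClosed_le (by fun_prop) continuous_const
  · rw [Metric.isBounded_iff]
    exact ⟨1, fun p hp q hq => by rw [dist_eq_norm]; exact h.norm_sub_le p hp q hq⟩

/-- Near a point `x` off `S`, all points of `C` have their diametral partners among those of `x`. -/
theorem IsUnitHull.eventually_partner_subset {S C : Set E} (h : IsUnitHull S C)
    {ω : E →ₗ[ℝ] E →ₗ[ℝ] ℝ} (hω : IsAreaForm ω) [FiniteDimensional ℝ E] {x : E} (hx : x ∈ C)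
    (hxS : x ∉ S) : ∀ᶠ z in 𝓝 x, z ∈ C → ∀ v ∈ C, ‖z - v‖ = 1 → ‖x - v‖ = 1 := by
  by_contra hcon
  obtain ⟨z, hz, hbad⟩ := exists_seq_forall_of_frequently (not_eventually.mp hcon)
  push Not at hbad
  choose hzC v hvC hzv hxv using hbad
  obtain ⟨y, hy, σ, hσ, hvy⟩ := h.isCompact_hull.tendsto_subseq hvC
  replace hz := hz.comp hσ.tendsto_atTop
  have hxy : ‖x - y‖ = 1 := by
    refine tendsto_nhds_unique (hz.sub hvy).norm ?_
    simp [hzv]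
  obtain ⟨η, hη0, hη2, hη⟩ : ∃ η, 0 < η ∧ η < 1 / 2 ∧ ∀ s ∈ S, 6 * η < ‖s - x‖ := by
    obtain ⟨ε, hε, hball⟩ := Metric.isOpen_iff.mp h.isCompact.isClosed.isOpen_compl x hxS
    refine ⟨min (ε / 7) (1 / 3), by positivity, (min_le_right _ _).trans_lt (by norm_num), ?_⟩
    intro s hs
    have : ¬ dist s x < ε := fun hlt => hball hlt hs
    rw [dist_eq_norm] at this
    linarith [min_le_left (ε / 7) (1 / 3)]
  have hclose (a : ℕ → E) {b : E} (hab : Tendsto a atTop (𝓝 b)) {r : ℝ} (hr : 0 < r) :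
      ∀ᶠ n in atTop, ‖a n - b‖ < r := by
    simpa [dist_eq_norm] using (Metric.tendsto_nhds.mp hab) r hr
  have hev : ∀ᶠ n in atTop, ∃ w ∈ S, ∃ φ : StrongDual ℝ E, ‖φ‖ ≤ 1 ∧
      φ (z (σ n) - v (σ n)) = 1 ∧ φ (w - v (σ n)) = 1 := by
    filter_upwards [hclose _ hz hη0, hclose _ hvy hη0] with n h1 h2
    refine h.exists_norming_pair hω hx hy (hzC _) (hvC _) hxS (fun hs => ?_) hxy (hzv _) (hxv _)
      hη2 hη h1 h2
    have := hη _ hs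
    simp only [Function.comp_apply] at h1
    linarith
  obtain ⟨N, hN⟩ := eventually_atTop.mp hev
  choose w hwS φ hφ hφz hφw using fun n => hN (n + N) (Nat.le_add_left N n)
  obtain ⟨w₀, hw₀, τ, hτ, hw⟩ := h.isCompact.tendsto_subseq hwS
  have hshift : Tendsto (fun n => τ n + N) atTop atTop :=
    (tendsto_add_atTop_nat N).comp hτ.tendsto_atTop
  replace hz := hz.comp hshift
  replace hvy := hvy.comp hshift
  have hwx : 0 < ‖w₀ - x‖ := by linarith [hη w₀ hw₀]
  have hw₀C := h.subset hw₀
  -- Norm 1 of the midpoints passes to the limit without convergence of the functionals; one norming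
  -- the limit norms both ends.
  have hmid : ‖(1 / 2 : ℝ) • (x - y) + (1 / 2 : ℝ) • (w₀ - y)‖ = 1 := by
    refine le_antisymm ?_ ?_
    · refine (norm_add_le _ _).trans ?_
      rw [norm_smul, norm_smul, hxy]
      have := h.norm_sub_le _ hw₀C _ hy
      norm_num
      linarith
    · refine ge_of_tendsto (((hz.sub hvy).const_smul (1 / 2 : ℝ)).add
        ((hw.sub hvy).const_smul (1 / 2 : ℝ))).norm (Eventually.of_forall fun n => ?_)
      refine le_trans (le_of_eq ?_) (apply_le_of_norm_le (hφ (τ n)) le_rfl)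
      simp only [Function.comp_apply, map_add, map_smul, hφz, hφw, smul_eq_mul]
      norm_num
  obtain ⟨ψ, hψ, hψ1⟩ := exists_norming hmid
  simp only [map_add, map_smul, smul_eq_mul] at hψ1
  have hψx' := apply_le_of_norm_le hψ hxy.le
  have hψw' := apply_le_of_norm_le hψ (h.norm_sub_le _ hw₀C _ hy)
  have hψx : ψ (x - y) = 1 := by linarith
  have hψw : ψ (w₀ - y) = 1 := by linarith
  -- The limit triangle is nondegenerate, so nearby ones have the same orientation.
  have hK : ω (w₀ - x) (x - y) ≠ 0 := by
    intro h0
    obtain ⟨t, ht⟩ := hω.exists_smul _ _ h0 (norm_pos_iff.mp hwx)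
    have e := congrArg ψ ht
    rw [map_smul, show w₀ - x = (w₀ - y) - (x - y) by abel, map_sub ψ (w₀ - y), hψx, hψw] at e
    simp at e
  have hωc : Continuous fun p : E × E => ω p.1 p.2 :=
    continuous_bilinear ω continuous_fst continuous_snd
  have hKt := (hωc.tendsto (w₀ - x, x - y)).comp ((hw.sub hz).prodMk_nhds (hz.sub hvy))
  have hKev := (hKt.const_mul (ω (w₀ - x) (x - y))).eventually_const_lt (mul_self_pos.mpr hK)
  obtain ⟨n, h1, h2, h3⟩ := ((hclose _ hz (half_pos hwx)).and
    ((hclose _ hw (half_pos hwx)).and hKev)).exists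
  simp only [Function.comp_apply] at h1 h2 h3
  rw [norm_sub_rev] at h1 h2
  have := hω.norming_eq_of_close h.norm_sub_le hx hw₀C hy (hzC _) (h.subset (hwS (τ n))) (hvC _)
    (hφ _) hψ hψx hψw (hφz (τ n)) (hφw (τ n)) (by linarith) h3
  refine hxv (σ (τ n + N)) ((h.norm_sub_le _ hx _ (hvC _)).antisymm ?_)
  rw [← this]
  exact apply_le_of_norm_le (hφ _) le_rfl

/-- Every point off `S` has a neighbourhood whose diametral partners are partners of a single
point of `S`. -/
theorem exists_partner_superset_nhds (hdim : Module.finrank ℝ E = 2) (hE : ¬ IsAngled E)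
    {S C : Set E} {d : ℝ} (hd : 0 < d) (hS : IsCompact S) (hne : S.Nonempty) (hSC : S ⊆ C)
    (hC : ∀ p, (∀ s ∈ S, dist p s ≤ d) → p ∈ C) (hdiam : ∀ p ∈ C, ∀ q ∈ C, dist p q ≤ d)
    {x : E} (hx : x ∈ C) (hxS : x ∉ S) :
    ∃ x' ∈ S, ∀ᶠ z in 𝓝 x, z ∈ C → ∀ v ∈ C, dist z v = d → dist x' v = d := by
  have : FiniteDimensional ℝ E := Module.finite_of_finrank_pos (by omega)
  obtain ⟨ω, hω⟩ := exists_isAreaForm hdim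
  -- Rescaling reduces to diameter 1.
  let f : E ≃ₜ E := Homeomorph.smulOfNeZero d hd.ne'
  have hf : ∀ p q, dist (f p) (f q) = d * ‖p - q‖ := fun p q => by
    simp only [f, Homeomorph.smulOfNeZero_apply]
    rw [dist_smul₀, Real.norm_of_nonneg hd.le, dist_eq_norm]
  have hf1 : ∀ p q, dist (f p) (f q) = d ↔ ‖p - q‖ = 1 := fun p q => by
    rw [hf]; exact mul_eq_left₀ hd.ne'
  have hf2 : ∀ p q, dist (f p) (f q) ≤ d ↔ ‖p - q‖ ≤ 1 := fun p q => by
    rw [hf]; exact mul_le_iff_le_one_right hd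
  have h : IsUnitHull (f ⁻¹' S) (f ⁻¹' C) := by
    refine ⟨f.isCompact_preimage.mpr hS, fun p => ⟨fun hp s hs => ?_, fun hp => ?_⟩, ?_,
      preimage_mono hSC⟩
    · exact (hf2 _ _).mp (hdiam _ hp _ (hSC hs))
    · refine hC _ fun s hs => ?_
      obtain ⟨s, rfl⟩ := f.surjective s
      exact (hf2 _ _).mpr (hp s hs)
    · exact fun p hp q hq => (hf2 _ _).mp (hdiam _ hp _ hq)
  obtain ⟨x, rfl⟩ := f.surjective x
  obtain ⟨x', hx', hsub⟩ := h.exists_partner_superset hE hω (hne.preimage f.surjective) hx hxS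
  refine ⟨f x', hx', ?_⟩
  rw [← f.map_nhds_eq, eventually_map]
  filter_upwards [h.eventually_partner_subset hω hx hxS] with z hz hzC v hv hzv
  obtain ⟨v, rfl⟩ := f.surjective v
  rw [hf1] at hzv ⊢
  exact hsub v hv (hz hzC v hv hzv)

/-- Extension of coverings for compact sets, without reference to extended diameters. -/
theorem exists_covering_extension (hdim : Module.finrank ℝ E = 2) (hE : ¬ IsAngled E)
    {S C : Set E} {d : ℝ} (hd : 0 < d) (hS : IsCompact S) (hne : S.Nonempty) (hCc : IsCompact C)
    (hSC : S ⊆ C) (hC : ∀ p, (∀ s ∈ S, dist p s ≤ d) → p ∈ C)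
    (hdiam : ∀ p ∈ C, ∀ q ∈ C, dist p q ≤ d) {ι : Type*} [Finite ι] {Q : ι → Set E} {k : ℕ∞}
    (hQS : ∀ i, Q i ⊆ S) (hQc : ∀ i, IsCompact (Q i)) {r : ℝ} (hr : 0 < r)
    (hQd : ∀ i, ∀ a ∈ Q i, ∀ b ∈ Q i, dist a b + 2 * r < d)
    (hcov : ∀ x ∈ S, k ≤ {i | x ∈ Q i}.encard) :
    ∃ Q' : ι → Set E, (∀ i, Q' i ⊆ C ∧ Q i ⊆ Q' i ∧ ediam (Q' i) < ENNReal.ofReal d) ∧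
      ∀ x ∈ C, k ≤ {i | x ∈ Q' i}.encard := by
  have : FiniteDimensional ℝ E := Module.finite_of_finrank_pos (by omega)
  have : ProperSpace E := FiniteDimensional.proper_real E
  have hloc : ∀ x ∈ C \ S, ∃ x' ∈ S, ∃ ε > 0, ∀ z ∈ closedBall x ε, z ∈ C → ∀ v ∈ C,
      dist z v = d → dist x' v = d := by
    rintro x ⟨hx, hxS⟩
    obtain ⟨x', hx', hev⟩ :=
      exists_partner_superset_nhds hdim hE hd hS hne hSC hC hdiam hx hxS
    obtain ⟨ε, hε, hball⟩ := Metric.nhds_basis_closedBall.eventually_iff.mp hev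
    exact ⟨x', hx', ε, hε, fun z hz => hball hz⟩
  choose! f hfS ε hε hf using hloc
  let K := C \ thickening r S
  have hKC : K ⊆ C \ S := sdiff_subset_sdiff_right (self_subset_thickening hr S)
  have hKc : IsCompact K := hCc.diff isOpen_thickening
  obtain ⟨t, htK, htcov⟩ := hKc.elim_nhds_subcover (fun x => closedBall x (ε x))
    (fun x hx => closedBall_mem_nhds x (hε x (hKC hx)))
  -- The ball about x goes to every `Q i` that contains its substitute `f x`.
  let Q' : ι → Set E := fun i =>
    C ∩ (cthickening r (Q i) ∪ ⋃ x ∈ {x ∈ (t : Set E) | f x ∈ Q i}, closedBall x (ε x))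
  have hQ'C : ∀ i, Q' i ⊆ C := fun i => inter_subset_left
  have hQ'c : ∀ i, IsCompact (Q' i) := fun i => by
    refine hCc.inter_right (isClosed_cthickening.union ?_)
    exact (t.finite_toSet.subset (sep_subset _ _)).isClosed_biUnion fun x _ => isClosed_closedBall
  have hthick : ∀ i, ∀ a ∈ cthickening r (Q i), ∃ q ∈ Q i, dist a q ≤ r := fun i a ha => by
    rw [(hQc i).cthickening_eq_biUnion_closedBall hr.le] at ha
    simpa using ha
  have hpart : ∀ i, ∀ a ∈ Q' i, (∃ q ∈ Q i, dist a q ≤ r) ∨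
      ∃ q ∈ Q i, ∀ v ∈ C, dist a v = d → dist q v = d := by
    rintro i a ⟨haC, ha | ha⟩
    · exact Or.inl (hthick i a ha)
    · simp only [mem_iUnion] at ha
      obtain ⟨x, ⟨hxt, hxQ⟩, hax⟩ := ha
      exact Or.inr ⟨f x, hxQ, fun v hv hav => hf x (hKC (htK x hxt)) a hax haC v hv hav⟩
  have hmixed : ∀ i, ∀ q ∈ Q i, ∀ b, (∃ q ∈ Q i, dist b q ≤ r) → dist q b < d := by
    rintro i q hq b ⟨q', hq', hb⟩
    have := hQd i q hq q' hq'
    have := dist_triangle q q' b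
    rw [dist_comm q' b] at this
    linarith
  -- Substitution preserves distance d, so a pair of partners in `Q' i` would yield one whose points
  -- lie in `Q i` or within r of it.
  have hindep : ∀ i, ∀ a ∈ Q' i, ∀ b ∈ Q' i, dist a b < d := by
    intro i a ha b hb
    refine (hdiam a (hQ'C i ha) b (hQ'C i hb)).lt_of_ne fun hab => ?_
    rcases hpart i a ha with ⟨q, hq, haq⟩ | ⟨q, hq, haq⟩
    · rcases hpart i b hb with ⟨q', hq', hbq⟩ | ⟨q', hq', hbq⟩
      · have := hQd i q hq q' hq'
        have := dist_triangle4 a q q' b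
        rw [dist_comm q' b] at this
        linarith
      · exact (hmixed i q' hq' a ⟨q, hq, haq⟩).ne (hbq a (hQ'C i ha) (by rwa [dist_comm]))
    · have hqb := haq b (hQ'C i hb) hab
      rcases hpart i b hb with hb' | ⟨q', hq', hbq⟩
      · exact (hmixed i q hq b hb').ne hqb
      · have h1 := hbq q (hSC (hQS i hq)) (by rwa [dist_comm])
        have h2 := hQd i q' hq' q hq
        linarith
  refine ⟨Q', fun i => ⟨hQ'C i, fun q hq => ⟨hSC (hQS i hq), Or.inl ?_⟩,
    (hQ'c i).ediam_lt_of_forall_dist_lt hd (hindep i)⟩, fun x hx => ?_⟩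
  · exact self_subset_cthickening (Q i) hq
  by_cases hxK : x ∈ thickening r S
  · obtain ⟨s, hs, hxs⟩ := mem_thickening_iff.mp hxK
    refine (hcov s hs).trans (encard_le_encard fun i hi => ⟨hx, Or.inl ?_⟩)
    exact mem_cthickening_of_dist_le x s r _ hi hxs.le
  · have := htcov (show x ∈ K from ⟨hx, hxK⟩)
    simp only [mem_iUnion] at this
    obtain ⟨y, hyt, hxy⟩ := this
    refine (hcov (f y) (hfS y (hKC (htK y hyt)))).trans
      (encard_le_encard fun i hi => ⟨hx, Or.inr ?_⟩)
    simp only [mem_iUnion]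
    exact ⟨y, ⟨hyt, hi⟩, hxy⟩

end

/-! ### Reduction to compact sets -/

theorem mainTheorem3 {E : Type*} [NormedAddCommGroup E] [NormedSpace ℝ E]
    (hdim : Module.finrank ℝ E = 2) (hE : ¬ IsAngled E)
    (S C : Set E) (hS : IsSetOfUniqueCompletion S) (hC : IsCompletion S C)
    (k : ℕ) {ι : Type*} [Finite ι] (Q : ι → Set E) (hQ : IsBorsukCovering k S Q) :
    ∃ Q' : ι → Set E, IsBorsukCovering k C Q' ∧ ∀ i, Q i ⊆ Q' i := by
  obtain ⟨hQS, hQd, hcov⟩ := hQ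
  have hfin := hC.ediam_ne_top
  have hne : S.Nonempty := by
    by_contra hempty
    rw [not_nonempty_iff_eq_empty] at hempty
    subst hempty
    have : Nontrivial E := Module.nontrivial_of_finrank_pos (R := ℝ) (by omega)
    obtain ⟨a, b, hab⟩ := exists_pair_ne E
    have hmem : ∀ p, p ∈ C := fun p => hC.mem_of_forall_edist_le hS (by simp)
    have := edist_le_ediam_of_mem (hmem a) (hmem b)
    rw [hC.2.2, ediam_empty, nonpos_iff_eq_zero, edist_eq_zero] at this
    exact hab this
  -- With no members, k is 0 and `S` may be a single point; a member makes the diameter of `S`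
  -- positive.
  rcases isEmpty_or_nonempty ι with hι | hι
  · obtain ⟨s, hs⟩ := hne
    refine ⟨Q, ⟨fun i => hι.elim i, fun i => hι.elim i, fun x _ => ?_⟩, fun i => hι.elim i⟩
    refine (hcov s hs).trans (encard_le_encard fun i => hι.elim i)
  obtain ⟨d, hd0, hd⟩ : ∃ d : ℝ, 0 < d ∧ ediam S = ENNReal.ofReal d := by
    refine ⟨(ediam S).toReal, ENNReal.toReal_pos ?_ hfin, (ENNReal.ofReal_toReal hfin).symm⟩
    exact (bot_le.trans_lt (hQd hι.some)).ne'
  have hdist : ∀ a b : E, edist a b ≤ ediam S ↔ dist a b ≤ d := fun a b => by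
    rw [hd, edist_le_ofReal hd0.le]
  have hdiam : ∀ p ∈ C, ∀ q ∈ C, dist p q ≤ d := fun p hp q hq =>
    (hdist p q).mp ((edist_le_ediam_of_mem hp hq).trans hC.2.2.le)
  have hCeq : C = ⋂ s ∈ S, closedBall s d := by
    ext p
    simp only [mem_iInter, mem_closedBall]
    exact ⟨fun hp s hs => hdiam p hp s (hC.2.1 hs),
      fun hp => hC.mem_of_forall_edist_le hS fun s hs => (hdist p s).mpr (hp s hs)⟩
  have : FiniteDimensional ℝ E := Module.finite_of_finrank_pos (by omega)
  have : ProperSpace E := FiniteDimensional.proper_real E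
  have hCclosed : IsClosed C := by
    rw [hCeq]; exact isClosed_biInter fun s _ => isClosed_closedBall
  have hCc : IsCompact C := isCompact_of_isClosed_isBounded hCclosed hC.1.1
  have hSC : closure S ⊆ C := closure_minimal hC.2.1 hCclosed
  have hSc : IsCompact (closure S) := hCc.of_isClosed_subset isClosed_closure hSC
  have hQcS : ∀ i, closure (Q i) ⊆ closure S := fun i => closure_mono (hQS i)
  have hr : ∀ i, ∃ r > 0, ∀ a ∈ closure (Q i), ∀ b ∈ closure (Q i), dist a b + 2 * r < d := by
    intro i
    have hlt := hQd i
    rw [← ediam_closure] at hlt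
    have hfi : ediam (closure (Q i)) ≠ ⊤ := hlt.ne_top
    have hlt' : (ediam (closure (Q i))).toReal < d := by
      rwa [hd, ENNReal.lt_ofReal_iff_toReal_lt hfi] at hlt
    refine ⟨(d - (ediam (closure (Q i))).toReal) / 3, by linarith, fun a ha b hb => ?_⟩
    have : dist a b ≤ (ediam (closure (Q i))).toReal := dist_le_diam_of_mem' hfi ha hb
    linarith
  choose r hr0 hr using hr
  obtain ⟨i₀, hi₀⟩ := Finite.exists_min r
  obtain ⟨Q', hQ', hcov'⟩ := exists_covering_extension hdim hE hd0 hSc hne.closure hCc hSC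
    (fun p hp => by
      rw [hCeq]
      simp only [mem_iInter, mem_closedBall]
      exact fun s hs => hp s (subset_closure hs))
    hdiam hQcS (fun i => hSc.of_isClosed_subset isClosed_closure (hQcS i)) (hr0 i₀)
    (fun i a ha b hb => by linarith [hr i a ha b hb, hi₀ i])
    (fun x hx => encard_le_of_mem_closure hcov hx)
  refine ⟨Q', ⟨fun i => (hQ' i).1, fun i => ?_, hcov'⟩, fun i => subset_closure.trans (hQ' i).2.1⟩
  rw [hC.2.2, hd]
  exact (hQ' i).2.2
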